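/- Let $K$ be a field of characteristic different from $2$, let $\Gamma=(\Gamma_0,\Gamma_1)$ be a finite quiver without oriented cycles (no path of length $\geq 1$ ends at the vertex where it starts), and let $\rho$ be a set of relations on $\Gamma$, i.e. of $K$-linear combinations of paths of length at least $2$ with a common start and a common end. In the path algebra $K\Gamma$ the product $xy$ of two paths is the path "first $y$, then $x$" if $y$ ends where $x$ starts, and $0$ otherwise. Let $\Lambda=K(\Gamma,\rho)=K\Gamma/\langle\rho\rangle$. Let $\Gamma_1^*$ consist of a reverse arrow $\alpha^*:j\to i$ for each arrow $\alpha:i\to j$ in $\Gamma_1$; for a path $p=\alpha_n\cdots\alpha_1$ of $\Gamma$ put $p^*=\alpha_1^*\cdots\alpha_n^*$ (with $e_i^*=e_i$ for trivial paths), extend $*$ linearly to $K\Gamma$, and let $\rho^*=\{\sigma^*:\sigma\in\rho\}$. The dual extension $\mathscr{D}(\Lambda)$ is the path algebra of the quiver $(\Gamma_0,\Gamma_1\cup\Gamma_1^*)$ modulo the ideal generated by $\rho\cup\rho^*\cup\{\alpha\beta^*:\alpha,\beta\in\Gamma_1\}$; elements of $\Lambda$ are regarded as elements of $\mathscr{D}(\Lambda)$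 through the natural algebra homomorphism $\Lambda\to\mathscr{D}(\Lambda)$. Let $\Theta:\mathscr{D}(\Lambda)\to\mathscr{D}(\Lambda)$ be a Lie derivation, i.e. a $K$-linear map with $\Theta([a,b])=[\Theta(a),b]+[a,\Theta(b)]$ for all $a,b$, where $[a,b]=ab-ba$. Then there is a derivation $D$ of $\mathscr{D}(\Lambda)$, i.e. a $K$-linear map with $D(ab)=D(a)b+aD(b)$ for all $a,b$, such that $\Theta(x)=D(x)$ for every $x=\sum_i k_ip_i\in\Lambda$ with $k_i\in K$ and $p_i$ nontrivial paths (paths of length $\geq 1$) of $\Gamma$; moreover, the same $D$ satisfies $\Theta(y)=D(y)$ for every linear combination $y\in\mathscr{D}(\Lambda)$ of nontrivial paths of $(\Gamma_0,\Gamma_1\cup\Gamma_1^*)$. -/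

import Mathlib

universe u v w

noncomputable section

open Quiver

/-- The set of all paths (of any length, with any end points) of a quiver. The element `⟨a, b, p⟩`
is a path `p` with start `s(p) = a` and end `e(p) = b`. -/
abbrev QuiverPath (V : Type v) [Quiver.{w + 1} V] : Type (max v (w + 1)) :=
  Σ a b : V, Path a b

namespace QuiverPath

variable {V : Type v} [Quiver.{w + 1} V]

/-- The number of arrows of a path. -/
def length (p : QuiverPath V) : ℕ := p.2.2.length

/-- A path is nontrivial if it consists of at least one arrow. -/
def IsNontrivial (p : QuiverPath V) : Prop := 1 ≤ p.length

end QuiverPath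

/-- A quiver has no oriented cycles if no nontrivial path ends where it starts. -/
def HasNoOrientedCycles (V : Type v) [Quiver.{w + 1} V] : Prop :=
  ∀ (a : V) (p : Path a a), p.length = 0

/-- The underlying vector space of the path algebra `KΓ`: finitely supported functions on the set
of paths, i.e. formal `K`-linear combinations of paths. -/
def PathAlgebra (K : Type u) [Field K] (V : Type v) [Quiver.{w + 1} V] : Type (max u v (w + 1)) :=
  QuiverPath V →₀ K

namespace PathAlgebra

variable {K : Type u} [Field K] {V : Type v} [Quiver.{w + 1} V]

instance : AddCommGroup (PathAlgebra K V) := inferInstanceAs (AddCommGroup (QuiverPath V →₀ K))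

instance : Module K (PathAlgebra K V) := inferInstanceAs (Module K (QuiverPath V →₀ K))

variable (K) in
/-- A path, seen as a basis element of the path algebra. -/
def ofPath (p : QuiverPath V) : PathAlgebra K V := Finsupp.single p 1

variable (K V) in
/-- The basis of the path algebra that consists of the paths. -/
def basis : Module.Basis (QuiverPath V) K (PathAlgebra K V) :=
  Module.Basis.ofRepr (LinearEquiv.refl K (QuiverPath V →₀ K))

@[simp]
theorem basis_apply (p : QuiverPath V) : basis K V p = ofPath K p := rfl

open Classical in
variable (K) in
/-- The product `x y` of two paths: it is "first `y`, then `x`" if `e(y) = s(x)`, and `0`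
otherwise. -/
def pathMul (x y : QuiverPath V) : PathAlgebra K V :=
  if h : y.2.1 = x.1 then ofPath K ⟨y.1, x.2.1, y.2.2.comp (x.2.2.cast h.symm rfl)⟩ else 0

theorem pathMul_comp {a b c : V} (p : Path b c) (q : Path a b) :
    pathMul K ⟨b, c, p⟩ ⟨a, b, q⟩ = ofPath K ⟨a, c, q.comp p⟩ := by
  simp [pathMul]

theorem pathMul_of_ne {x y : QuiverPath V} (h : y.2.1 ≠ x.1) : pathMul K x y = 0 := by
  simp [pathMul, h]

variable (K V) in
/-- The bilinear extension of the product of paths. -/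
def mulLin : PathAlgebra K V →ₗ[K] PathAlgebra K V →ₗ[K] PathAlgebra K V :=
  (basis K V).constr K fun x => (basis K V).constr K fun y => pathMul K x y

instance : Mul (PathAlgebra K V) := ⟨fun x y => mulLin K V x y⟩

theorem mul_eq_mulLin (x y : PathAlgebra K V) : x * y = mulLin K V x y := rfl

theorem ofPath_mul_ofPath (x y : QuiverPath V) :
    ofPath K x * ofPath K y = pathMul K x y := by
  rw [mul_eq_mulLin, mulLin, ← basis_apply, ← basis_apply, Module.Basis.constr_basis,
    Module.Basis.constr_basis]

/-- The trivial path `e_i` at the vertex `i`. -/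
def idem (K : Type u) [Field K] {V : Type v} [Quiver.{w + 1} V] (i : V) : PathAlgebra K V :=
  ofPath K ⟨i, i, Path.nil⟩

/-- The identity of the path algebra of a finite quiver is the sum of the trivial paths. -/
instance [Fintype V] : One (PathAlgebra K V) := ⟨∑ i : V, idem K i⟩

theorem one_def [Fintype V] : (1 : PathAlgebra K V) = ∑ i : V, idem K i := rfl

theorem induction_on {P : PathAlgebra K V → Prop} (x : PathAlgebra K V) (h0 : P 0)
    (hadd : ∀ x y, P x → P y → P (x + y)) (hsmul : ∀ (k : K) (p : QuiverPath V),
      P (k • ofPath K p)) : P x := by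
  have hx : x ∈ Submodule.span K (Set.range (basis K V)) := by
    rw [(basis K V).span_eq]; trivial
  have key : ∀ k : K, P (k • x) := by
    induction hx using Submodule.span_induction with
    | mem y hy => obtain ⟨p, rfl⟩ := hy; exact fun k => hsmul k p
    | zero => intro k; simpa using h0
    | add y z _ _ hy hz => intro k; rw [smul_add]; exact hadd _ _ (hy k) (hz k)
    | smul c y _ hy => intro k; rw [smul_smul]; exact hy _
  simpa using key 1

theorem add_mul' (x y z : PathAlgebra K V) : (x + y) * z = x * z + y * z := by
  simp [mul_eq_mulLin]

theorem mul_add' (x y z : PathAlgebra K V) : x * (y + z) = x * y + x * z := by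
  simp [mul_eq_mulLin]

theorem smul_mul' (k : K) (x y : PathAlgebra K V) : (k • x) * y = k • (x * y) := by
  simp [mul_eq_mulLin]

theorem mul_smul' (k : K) (x y : PathAlgebra K V) : x * (k • y) = k • (x * y) := by
  simp [mul_eq_mulLin]

theorem zero_mul' (x : PathAlgebra K V) : 0 * x = 0 := by simp [mul_eq_mulLin]

theorem mul_zero' (x : PathAlgebra K V) : x * 0 = 0 := by simp [mul_eq_mulLin]

theorem ofPath_mul_assoc (x y z : QuiverPath V) :
    ofPath K x * ofPath K y * ofPath K z = ofPath K x * (ofPath K y * ofPath K z) := by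
  obtain ⟨x₁, x₂, p⟩ := x
  obtain ⟨y₁, y₂, q⟩ := y
  obtain ⟨z₁, z₂, r⟩ := z
  rw [ofPath_mul_ofPath, ofPath_mul_ofPath]
  by_cases h : y₂ = x₁
  · subst h
    rw [pathMul_comp, ofPath_mul_ofPath]
    by_cases h' : z₂ = y₁
    · subst h'
      rw [pathMul_comp, pathMul_comp, ofPath_mul_ofPath, pathMul_comp, Path.comp_assoc]
    · rw [pathMul_of_ne (by exact h'), pathMul_of_ne (by exact h'), mul_zero']
  · rw [pathMul_of_ne (by exact h), zero_mul']
    by_cases h' : z₂ = y₁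
    · subst h'
      rw [pathMul_comp, ofPath_mul_ofPath, pathMul_of_ne (by exact h)]
    · rw [pathMul_of_ne (by exact h'), mul_zero']

theorem mul_assoc' (x y z : PathAlgebra K V) : x * y * z = x * (y * z) := by
  induction x using induction_on with
  | h0 => simp only [zero_mul']
  | hadd x x' hx hx' => simp only [add_mul', hx, hx']
  | hsmul k p =>
    induction y using induction_on with
    | h0 => simp only [zero_mul', mul_zero']
    | hadd y y' hy hy' => simp only [add_mul', mul_add', hy, hy']
    | hsmul l q =>
      induction z using induction_on with
      | h0 => simp only [mul_zero']
      | hadd z z' hz hz' => simp only [mul_add', hz, hz']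
      | hsmul m r => simp only [smul_mul', mul_smul', ofPath_mul_assoc]

theorem sum_mul' {ι : Type*} (s : Finset ι) (f : ι → PathAlgebra K V) (x : PathAlgebra K V) :
    (∑ i ∈ s, f i) * x = ∑ i ∈ s, f i * x := by
  simp [mul_eq_mulLin, map_sum, LinearMap.sum_apply]

theorem mul_sum' {ι : Type*} (s : Finset ι) (f : ι → PathAlgebra K V) (x : PathAlgebra K V) :
    x * (∑ i ∈ s, f i) = ∑ i ∈ s, x * f i := by
  simp [mul_eq_mulLin, map_sum]

theorem one_mul' [Fintype V] (x : PathAlgebra K V) : 1 * x = x := by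
  induction x using induction_on with
  | h0 => rw [mul_zero']
  | hadd x y hx hy => rw [mul_add', hx, hy]
  | hsmul k p =>
    obtain ⟨a, b, p⟩ := p
    rw [mul_smul', one_def, sum_mul', Finset.sum_eq_single b]
    · rw [idem, ofPath_mul_ofPath, pathMul_comp, Path.comp_nil]
    · intro i _ hi
      rw [idem, ofPath_mul_ofPath, pathMul_of_ne (by exact hi.symm)]
    · intro h; exact absurd (Finset.mem_univ b) h

theorem mul_one' [Fintype V] (x : PathAlgebra K V) : x * 1 = x := by
  induction x using induction_on with
  | h0 => rw [zero_mul']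
  | hadd x y hx hy => rw [add_mul', hx, hy]
  | hsmul k p =>
    obtain ⟨a, b, p⟩ := p
    rw [smul_mul', one_def, mul_sum', Finset.sum_eq_single a]
    · rw [idem, ofPath_mul_ofPath, pathMul_comp, Path.nil_comp]
    · intro i _ hi
      rw [idem, ofPath_mul_ofPath, pathMul_of_ne (by exact hi)]
    · intro h; exact absurd (Finset.mem_univ a) h

instance [Fintype V] : Ring (PathAlgebra K V) where
  __ := (inferInstance : AddCommGroup (PathAlgebra K V))
  mul := (· * ·)
  one := 1
  left_distrib := mul_add'
  right_distrib := add_mul'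
  zero_mul := zero_mul'
  mul_zero := mul_zero'
  mul_assoc := mul_assoc'
  one_mul := one_mul'
  mul_one := mul_one'

instance [Fintype V] : Algebra K (PathAlgebra K V) :=
  Algebra.ofModule smul_mul' (fun k x y => mul_smul' k x y)

/-- A relation on the quiver: a linear combination of paths of length at least two that all have
the same start and the same end. -/
def IsRelation (σ : PathAlgebra K V) : Prop :=
  ∃ a b : V, σ ∈ Submodule.span K
    {x | ∃ p : Path a b, 2 ≤ p.length ∧ x = ofPath K (⟨a, b, p⟩ : QuiverPath V)}

end PathAlgebra

section Quotient

variable {K : Type u} [Field K] {V : Type v} [Quiver.{w + 1} V] [Fintype V]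

/-- The algebra `K(Γ, ρ)`: the quotient of the path algebra `KΓ` by the two-sided ideal generated
by `ρ`. -/
def BoundPathAlgebra (ρ : Set (PathAlgebra K V)) : Type (max u v (w + 1)) :=
  (TwoSidedIdeal.span ρ).ringCon.Quotient

namespace BoundPathAlgebra

variable (ρ : Set (PathAlgebra K V))

instance : Ring (BoundPathAlgebra ρ) :=
  inferInstanceAs (Ring (TwoSidedIdeal.span ρ).ringCon.Quotient)

instance : Algebra K (BoundPathAlgebra ρ) :=
  inferInstanceAs (Algebra K (TwoSidedIdeal.span ρ).ringCon.Quotient)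

/-- The quotient map from `KΓ` to `K(Γ, ρ)`. -/
def mk : PathAlgebra K V →ₐ[K] BoundPathAlgebra ρ where
  toRingHom := (TwoSidedIdeal.span ρ).ringCon.mk'
  commutes' _ := rfl

theorem mk_surjective : Function.Surjective (mk ρ) :=
  RingCon.mk'_surjective _

theorem mk_eq_mk_iff {x y : PathAlgebra K V} :
    mk ρ x = mk ρ y ↔ x - y ∈ TwoSidedIdeal.span ρ := by
  rw [← TwoSidedIdeal.rel_iff]
  exact (RingCon.eq _)

theorem mk_eq_zero_iff {x : PathAlgebra K V} : mk ρ x = 0 ↔ x ∈ TwoSidedIdeal.span ρ := by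
  rw [← map_zero (mk ρ), mk_eq_mk_iff, sub_zero]

/-- The subspace of the linear combinations `∑ kᵢ pᵢ` of (classes of) nontrivial paths. -/
def nontrivialSpan : Submodule K (BoundPathAlgebra ρ) :=
  Submodule.span K {x | ∃ p : QuiverPath V, p.IsNontrivial ∧ x = mk ρ (PathAlgebra.ofPath K p)}

/-- An algebra homomorphism out of `KΓ` that kills `ρ` factors through `K(Γ, ρ)`. -/
def lift {A : Type*} [Ring A] [Algebra K A] (f : PathAlgebra K V →ₐ[K] A)
    (hf : ∀ σ ∈ ρ, f σ = 0) : BoundPathAlgebra ρ →ₐ[K] A where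
  toRingHom := (TwoSidedIdeal.span ρ).ringCon.lift f.toRingHom (by
    have h : TwoSidedIdeal.span ρ ≤ TwoSidedIdeal.ker f :=
      TwoSidedIdeal.span_le.2 fun σ hσ => (TwoSidedIdeal.mem_ker f).2 (hf σ hσ)
    intro x y hxy
    exact (TwoSidedIdeal.ker_ringCon f).1 (TwoSidedIdeal.ringCon_le_iff.1 h hxy))
  commutes' k := f.commutes k

@[simp]
theorem lift_mk {A : Type*} [Ring A] [Algebra K A] (f : PathAlgebra K V →ₐ[K] A)
    (hf : ∀ σ ∈ ρ, f σ = 0) (x : PathAlgebra K V) : lift ρ f hf (mk ρ x) = f x := rfl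

end BoundPathAlgebra

end Quotient

section Dual

variable {K : Type u} [Field K] {V : Type v} [Quiver.{w + 1} V]

/-- The quiver `(Γ₀, Γ₁ ∪ Γ₁*)` is `Symmetrify V`: its arrows from `i` to `j` are the arrows from
`i` to `j` of `Γ` and a reverse `α*` of each arrow `α` from `j` to `i`. It has the same (finite)
set of vertices. -/
instance [Fintype V] : Fintype (Symmetrify V) := inferInstanceAs (Fintype V)

/-- A path of `Γ`, seen as a path of `(Γ₀, Γ₁ ∪ Γ₁*)`. -/
def pathIncl (p : QuiverPath V) : QuiverPath (Symmetrify V) :=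
  ⟨Symmetrify.of.obj p.1, Symmetrify.of.obj p.2.1, Symmetrify.of.mapPath p.2.2⟩

/-- The path `p* = α₁* ⋯ αₙ*` for a path `p = αₙ ⋯ α₁` of `Γ`. -/
def pathStar (p : QuiverPath V) : QuiverPath (Symmetrify V) :=
  ⟨Symmetrify.of.obj p.2.1, Symmetrify.of.obj p.1, (Symmetrify.of.mapPath p.2.2).reverse⟩

variable (K V) in
/-- The linear map from `KΓ` to the path algebra of `(Γ₀, Γ₁ ∪ Γ₁*)` with `p ↦ p`. -/
def inclLin : PathAlgebra K V →ₗ[K] PathAlgebra K (Symmetrify V) :=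
  (PathAlgebra.basis K V).constr K fun p => PathAlgebra.ofPath K (pathIncl p)

variable (K V) in
/-- The linear map from `KΓ` to the path algebra of `(Γ₀, Γ₁ ∪ Γ₁*)` with `p ↦ p*`. -/
def starLin : PathAlgebra K V →ₗ[K] PathAlgebra K (Symmetrify V) :=
  (PathAlgebra.basis K V).constr K fun p => PathAlgebra.ofPath K (pathStar p)

theorem inclLin_ofPath (p : QuiverPath V) :
    inclLin K V (PathAlgebra.ofPath K p) = PathAlgebra.ofPath K (pathIncl p) := by
  rw [inclLin, ← PathAlgebra.basis_apply, Module.Basis.constr_basis]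

theorem starLin_ofPath (p : QuiverPath V) :
    starLin K V (PathAlgebra.ofPath K p) = PathAlgebra.ofPath K (pathStar p) := by
  rw [starLin, ← PathAlgebra.basis_apply, Module.Basis.constr_basis]

/-- The path of length one given by an arrow. -/
def arrowPath {a b : V} (α : a ⟶ b) : QuiverPath V := ⟨a, b, α.toPath⟩

/-- The set `ρ ∪ ρ* ∪ {α β* | α, β ∈ Γ₁}`. (The product `α β*` is `0` unless `s(α) = s(β)`.) -/
def dualRelations (ρ : Set (PathAlgebra K V)) : Set (PathAlgebra K (Symmetrify V)) :=
  inclLin K V '' ρ ∪ starLin K V '' ρ ∪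
    {x | ∃ (a b c d : V) (α : a ⟶ b) (β : c ⟶ d), x =
      PathAlgebra.ofPath K (pathIncl (arrowPath α)) *
        PathAlgebra.ofPath K (pathStar (arrowPath β))}

variable [Fintype V]

/-- The dual extension `𝒟(Λ)` of `Λ = K(Γ, ρ)`: the path algebra of `(Γ₀, Γ₁ ∪ Γ₁*)` with
relations `ρ ∪ ρ* ∪ {α β* | α, β ∈ Γ₁}`. -/
abbrev DualExtension (ρ : Set (PathAlgebra K V)) : Type (max u v (w + 1)) :=
  BoundPathAlgebra (dualRelations ρ)

variable (K V) in
/-- The inclusion of `KΓ` in the path algebra of `(Γ₀, Γ₁ ∪ Γ₁*)`, as an algebra homomorphism. -/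
def inclHom : PathAlgebra K V →ₐ[K] PathAlgebra K (Symmetrify V) :=
  AlgHom.ofLinearMap (inclLin K V)
    (by
      rw [PathAlgebra.one_def, PathAlgebra.one_def, map_sum]
      exact Finset.sum_congr rfl fun i _ => inclLin_ofPath _)
    (by
      intro x y
      induction x using PathAlgebra.induction_on with
      | h0 => simp
      | hadd x x' hx hx' => rw [add_mul, map_add, hx, hx', map_add, add_mul]
      | hsmul k p =>
        induction y using PathAlgebra.induction_on with
        | h0 => simp
        | hadd y y' hy hy' => rw [mul_add, map_add, hy, hy', map_add, mul_add]
        | hsmul l q =>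
          simp only [smul_mul_assoc, mul_smul_comm, map_smul, inclLin_ofPath]
          congr 2
          obtain ⟨a, b, p⟩ := p
          obtain ⟨c, d, q⟩ := q
          rw [PathAlgebra.ofPath_mul_ofPath, PathAlgebra.ofPath_mul_ofPath]
          by_cases h : d = a
          · subst h
            rw [PathAlgebra.pathMul_comp, inclLin_ofPath]
            simp only [pathIncl]
            rw [PathAlgebra.pathMul_comp, Prefunctor.mapPath_comp]
          · rw [PathAlgebra.pathMul_of_ne (by exact h), map_zero,
              PathAlgebra.pathMul_of_ne (by exact h)])

/-- The natural algebra homomorphism from `Λ = K(Γ, ρ)` to `𝒟(Λ)`, through which the elements of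
`Λ` are seen as elements of `𝒟(Λ)`. -/
def toDualExtension (ρ : Set (PathAlgebra K V)) : BoundPathAlgebra ρ →ₐ[K] DualExtension ρ :=
  BoundPathAlgebra.lift ρ ((BoundPathAlgebra.mk (dualRelations ρ)).comp (inclHom K V))
    (fun σ hσ => (BoundPathAlgebra.mk_eq_zero_iff _).2
      (TwoSidedIdeal.subset_span (Or.inl (Or.inl ⟨σ, hσ, rfl⟩))))

end Dual

/-- An (associative) derivation of a not necessarily commutative algebra `A`: a linear map `D` with
`D(ab) = D(a) b + a D(b)`. -/
def IsAssocDerivation {K : Type*} [Field K] {A : Type*} [Ring A] [Algebra K A] (D : A →ₗ[K] A) :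
    Prop :=
  ∀ a b : A, D (a * b) = D a * b + a * D b

/-- A Lie derivation of an associative algebra `A`: a linear map `Θ` with
`Θ([a, b]) = [Θ(a), b] + [a, Θ(b)]`, where `[a, b] = ab - ba`. -/
def IsLieDerivation {K : Type*} [Field K] {A : Type*} [Ring A] [Algebra K A] (Θ : A →ₗ[K] A) :
    Prop :=
  ∀ a b : A, Θ ⁅a, b⁆ = ⁅Θ a, b⁆ + ⁅a, Θ b⁆

end

/-! Up to an inner derivation, Θ is an associative derivation plus a central-valued map that
vanishes on commutators and sees only the coefficients of the trivial paths. Nontrivial paths do not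
feel the second summand. Let e be the idempotents of the vertices. An inner derivation makes every
Θ(e_i) diagonal (`exists_innerLin`). Since 2 ≠ 0, Θ then preserves the off-diagonal Peirce
components, which forces every Θ(e_i) to be central (`commute_map_idempotent`). The augmentation ε
onto K^Γ₀ exists because all relations are combinations of nontrivial paths. Subtracting τ(x) = ∑
ε(x)_i Θ(e_i) leaves a Lie derivation that kills the e_i. Such a map is associative
(`IsDirectedPeirce.isAssocDerivation`) because xy or yx usually vanishes, so that the bracket is a
single product up to sign. Here the dual extension enters: αβ* = 0 lets only words q*p survive, and
acyclicity then yields the vanishing products collected in `IsDirectedPeirce`, with reachability as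
the relation. -/

noncomputable section
open Quiver

/-! ### Peirce components of a complete family of orthogonal idempotents -/

section Peirce

variable {K : Type*} [Field K] {A : Type*} [Ring A] [Algebra K A] {V : Type*}

variable (K) in
/-- The Peirce component `e i * A * e j` of a family `e`. -/
def peirceSpace (e : V → A) (i j : V) : Submodule K A where
  carrier := {x | e i * x = x ∧ x * e j = x}
  add_mem' := by
    rintro x y ⟨h1, h2⟩ ⟨h3, h4⟩
    exact ⟨by rw [mul_add, h1, h3], by rw [add_mul, h2, h4]⟩
  zero_mem' := by simp
  smul_mem' := by
    rintro c x ⟨h1, h2⟩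
    exact ⟨by rw [mul_smul_comm, h1], by rw [smul_mul_assoc, h2]⟩

variable (K) in
/-- The span of the products of elements of `e i * A * e k` and of `e k * A * e i` for `k ≠ i`. -/
def peirceLoops (e : V → A) (i : V) : Submodule K A :=
  Submodule.span K
    {z | ∃ k, k ≠ i ∧ ∃ q ∈ peirceSpace K e i k, ∃ p ∈ peirceSpace K e k i, z = q * p}

variable (K) in
/-- A complete family of orthogonal idempotents `e` is directed by the antisymmetric relation `R`
if `e k * A * e i * A * e m = 0` unless `R k i` or `R m i` holds, and if every diagonal Peirce
component is spanned by its idempotent and by products of off-diagonal elements. -/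
structure IsDirectedPeirce [Fintype V] (e : V → A) (R : V → V → Prop) : Prop where
  coi : CompleteOrthogonalIdempotents e
  antisymm : ∀ i j, R i j → R j i → i = j
  mul_eq_zero : ∀ k i m, ¬ R k i → ¬ R m i →
    ∀ x ∈ peirceSpace K e k i, ∀ y ∈ peirceSpace K e i m, x * y = 0
  diag : ∀ i, ∀ x ∈ peirceSpace K e i i, ∃ c : K, x - c • e i ∈ peirceLoops K e i

theorem mul_mem_peirceSpace {e : V → A} {i j k l : V} {x y : A} (hx : x ∈ peirceSpace K e i j)
    (hy : y ∈ peirceSpace K e k l) : x * y ∈ peirceSpace K e i l :=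
  ⟨by rw [← mul_assoc, hx.1], by rw [mul_assoc, hy.2]⟩

theorem peirceLoops_le (e : V → A) (i : V) : peirceLoops K e i ≤ peirceSpace K e i i := by
  rw [peirceLoops, Submodule.span_le]
  rintro z ⟨k, -, q, hq, p, hp, rfl⟩
  exact mul_mem_peirceSpace hq hp

variable [Fintype V] {e : V → A}

namespace CompleteOrthogonalIdempotents

theorem mul_mul_mem_peirceSpace (he : CompleteOrthogonalIdempotents e) (i j : V) (x : A) :
    e i * x * e j ∈ peirceSpace K e i j :=
  ⟨by rw [← mul_assoc, ← mul_assoc, (he.idem i).eq], by rw [mul_assoc, (he.idem j).eq]⟩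

theorem peirce_mul_eq_zero (he : CompleteOrthogonalIdempotents e) {i j k l : V} (hjk : j ≠ k)
    {x y : A} (hx : x ∈ peirceSpace K e i j) (hy : y ∈ peirceSpace K e k l) : x * y = 0 := by
  rw [← hx.2, ← hy.1, mul_assoc, ← mul_assoc (e j), he.ortho hjk, zero_mul, mul_zero]

theorem eq_sum_peirce (he : CompleteOrthogonalIdempotents e) (x : A) :
    x = ∑ i, ∑ j, e i * x * e j := by
  simp_rw [← Finset.mul_sum, he.complete, mul_one, ← Finset.sum_mul, he.complete, one_mul]

variable (K) in
theorem peirce_induction (he : CompleteOrthogonalIdempotents e) {P : A → Prop} (h0 : P 0)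
    (hadd : ∀ x y, P x → P y → P (x + y)) (h : ∀ i j, ∀ x ∈ peirceSpace K e i j, P x) (x : A) : P x := by
  rw [he.eq_sum_peirce x]
  exact Finset.sum_induction _ P hadd h0 fun i _ => Finset.sum_induction _ P hadd h0 fun j _ =>
    h i j _ (he.mul_mul_mem_peirceSpace i j x)

theorem eq_of_peirce (he : CompleteOrthogonalIdempotents e) {x y : A}
    (h : ∀ i j, e i * x * e j = e i * y * e j) : x = y := by
  rw [he.eq_sum_peirce x, he.eq_sum_peirce y]
  simp_rw [h]

theorem mem_peirce_of (he : CompleteOrthogonalIdempotents e) {x : A} {i j : V}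
    (h : ∀ k l, (k ≠ i ∨ l ≠ j) → e k * x * e l = 0) : x ∈ peirceSpace K e i j := by
  classical
  have hx : x = e i * x * e j := by
    conv_lhs => rw [he.eq_sum_peirce x]
    rw [Finset.sum_eq_single i, Finset.sum_eq_single j]
    · exact fun l _ hl => h i l (Or.inr hl)
    · exact fun hh => absurd (Finset.mem_univ _) hh
    · exact fun k _ hk => Finset.sum_eq_zero fun l _ => h k l (Or.inl hk)
    · exact fun hh => absurd (Finset.mem_univ _) hh
  rw [hx]
  exact he.mul_mul_mem_peirceSpace i j x

end CompleteOrthogonalIdempotents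

/-! ### Lie derivations and Peirce components -/

/-- The inner derivation `x ↦ t x - x t`. -/
def innerLin (K : Type*) [Field K] {A : Type*} [Ring A] [Algebra K A] (t : A) : A →ₗ[K] A :=
  LinearMap.mulLeft K t - LinearMap.mulRight K t

theorem innerLin_apply (t x : A) : innerLin K t x = t * x - x * t := rfl

theorem isAssocDerivation_innerLin (t : A) : IsAssocDerivation (innerLin K t) := by
  intro a b
  simp only [innerLin_apply]
  noncomm_ring

theorem IsAssocDerivation.isLieDerivation {D : A →ₗ[K] A} (hD : IsAssocDerivation D) :
    IsLieDerivation D := by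
  intro a b
  simp only [Ring.lie_def, map_sub, hD a b, hD b a]
  noncomm_ring

theorem IsAssocDerivation.add {D E : A →ₗ[K] A} (hD : IsAssocDerivation D)
    (hE : IsAssocDerivation E) : IsAssocDerivation (D + E) := by
  intro a b
  simp only [LinearMap.add_apply, hD a b, hE a b]
  noncomm_ring

theorem IsLieDerivation.sub {D E : A →ₗ[K] A} (hD : IsLieDerivation D)
    (hE : IsLieDerivation E) : IsLieDerivation (D - E) := by
  intro a b
  simp only [LinearMap.sub_apply, hD a b, hE a b]
  simp only [Ring.lie_def]
  noncomm_ring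

namespace IsLieDerivation

variable {Θ : A →ₗ[K] A}

/-- A Lie derivation maps idempotents to diagonal elements, up to an inner derivation. -/
theorem exists_innerLin (hΘ : IsLieDerivation Θ) (he : CompleteOrthogonalIdempotents e) :
    ∃ t : A, ∀ i k l, k ≠ l → e k * (Θ - innerLin K t) (e i) * e l = 0 := by
  classical
  -- This t satisfies t e_m = Θ(e_m) e_m. The (k, l) corner of Θ(e_i) - [t, e_i] is then exactly the
  -- (k, l) corner of Θ applied to [e_i, e_l] = 0.
  refine ⟨∑ l, Θ (e l) * e l, fun i k l hkl => ?_⟩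
  set t := ∑ l, Θ (e l) * e l with ht
  have htl : ∀ m, t * e m = Θ (e m) * e m := by
    intro m
    rw [ht, Finset.sum_mul, Finset.sum_eq_single m]
    · rw [mul_assoc, (he.idem m).eq]
    · intro j _ hj
      rw [mul_assoc, he.ortho hj, mul_zero]
    · exact fun hh => absurd (Finset.mem_univ _) hh
  have hc : ⁅e i, e l⁆ = 0 := by
    rw [Ring.lie_def, he.mul_eq, he.mul_eq]
    by_cases h : i = l
    · simp [h]
    · simp [h, Ne.symm h]
  have h := hΘ (e i) (e l)
  rw [hc, map_zero, Ring.lie_def, Ring.lie_def] at h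
  have h2 := congrArg (fun x => e k * x * e l) h
  have hl := (he.idem l).eq
  have e1 : e k * e l = 0 := he.ortho hkl
  have e2 : e k * (Θ (e i) * e l - e l * Θ (e i) + (e i * Θ (e l) - Θ (e l) * e i)) * e l =
      e k * Θ (e i) * (e l * e l) - (e k * e l) * Θ (e i) * e l + (e k * e i) * Θ (e l) * e l
        - e k * Θ (e l) * (e i * e l) := by noncomm_ring
  simp only [mul_zero, zero_mul, e2, hl, e1, sub_zero] at h2
  have e3 : e k * (Θ - innerLin K t) (e i) * e l =
      e k * Θ (e i) * e l - e k * (t * e i) * e l + (e k * e i) * (t * e l) := by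
    rw [LinearMap.sub_apply, innerLin_apply]; noncomm_ring
  rw [e3, htl, htl]
  have e4 : e k * (Θ (e i) * e i) * e l = e k * Θ (e l) * (e i * e l) := by
    rw [he.mul_eq i l]
    split_ifs with h
    · subst h; rw [mul_assoc, mul_assoc, hl, mul_assoc]
    · rw [← mul_assoc, mul_assoc _ (e i), he.ortho h, mul_zero, mul_zero]
  rw [e4, h2]
  noncomm_ring

/-- A Lie derivation that maps the idempotents to diagonal elements preserves the off-diagonal
Peirce components. -/
theorem map_mem_peirce (hK : (2 : K) ≠ 0) (hΘ : IsLieDerivation Θ)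
    (he : CompleteOrthogonalIdempotents e)
    (hd : ∀ i k l, k ≠ l → e k * Θ (e i) * e l = 0) {i j : V} (hij : i ≠ j) {x : A}
    (hx : x ∈ peirceSpace K e i j) : Θ x ∈ peirceSpace K e i j := by
  classical
  have hji := hij.symm
  have hxi : x * e i = 0 := by rw [← hx.2, mul_assoc, he.ortho hji, mul_zero]
  have hxj : e j * x = 0 := by rw [← hx.1, ← mul_assoc, he.ortho hji, zero_mul]
  have two : ∀ y : A, y = -y → y = 0 := by
    intro y hy
    have : (2 : K) • y = 0 := by rw [two_smul]; nth_rewrite 1 [hy]; simp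
    exact (smul_eq_zero.1 this).resolve_left hK
  have hi : Θ x = Θ (e i) * x - x * Θ (e i) + (e i * Θ x - Θ x * e i) := by
    have := hΘ (e i) x
    simp only [Ring.lie_def] at this
    rw [hx.1, hxi, sub_zero] at this
    exact this
  have hj : Θ x = Θ x * e j - e j * Θ x + (x * Θ (e j) - Θ (e j) * x) := by
    have := hΘ x (e j)
    simp only [Ring.lie_def] at this
    rw [hx.2, hxj, sub_zero] at this
    exact this
  -- Since Θ(e_m) is diagonal, Θ(e_m) x and x Θ(e_m) have no corner other than (i, j). Elsewhere
  -- only the brackets of Θ(x) with e_i and e_j count.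
  have key : ∀ m k l, (k ≠ i ∨ l ≠ j) → e k * (Θ (e m) * x) * e l = 0 := by
    intro m k l h
    by_cases hk : k = i
    · have hl : l ≠ j := h.resolve_left (fun h => h hk)
      rw [← hx.2, mul_assoc, mul_assoc, mul_assoc x, he.ortho hl.symm]
      simp
    · rw [← hx.1, ← mul_assoc, ← mul_assoc, hd m k i hk]
      simp
  have key' : ∀ m k l, (k ≠ i ∨ l ≠ j) → e k * (x * Θ (e m)) * e l = 0 := by
    intro m k l h
    by_cases hk : k = i
    · have hl : l ≠ j := h.resolve_left (fun h => h hk)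
      rw [← hx.2, mul_assoc, mul_assoc, mul_assoc x, ← mul_assoc (e j), hd m j l hl.symm]
      simp
    · rw [← hx.1, ← mul_assoc, ← mul_assoc, he.ortho hk]
      simp
  refine he.mem_peirce_of fun k l hkl => ?_
  have hi' := congrArg (fun x => e k * x * e l) hi
  have hj' := congrArg (fun x => e k * x * e l) hj
  simp only [mul_add, mul_sub, add_mul, sub_mul, key _ _ _ hkl, key' _ _ _ hkl, sub_zero,
    add_zero, zero_add] at hi' hj'
  rw [← mul_assoc (e k), ← mul_assoc (e k), mul_assoc _ (e i) (e l), he.mul_eq, he.mul_eq] at hi'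
  rw [← mul_assoc (e k), ← mul_assoc (e k), mul_assoc _ (e j) (e l), he.mul_eq, he.mul_eq] at hj'
  -- In row i the bracket with e_j kills the corner; in the other rows the bracket with e_i does. In
  -- column i the latter only says that the corner is its own negative, which is where
  -- characteristic ≠ 2 is needed.
  by_cases hki : k = i
  · have hlj : l ≠ j := hkl.resolve_left (fun h => h hki)
    subst hki
    by_cases hkj : k = j
    · exact absurd hkj hij
    · simpa [hlj, Ne.symm hlj, hkj] using hj'
  · by_cases hil : i = l
    · subst hil
      simp only [hki, if_false, zero_mul, if_true, zero_sub] at hi'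
      exact two _ hi'
    · simpa [hki, hil] using hi'

/-- Bracketing with e_m is multiplication by one scalar on the whole (i, j) component, which
contains both x and Θ(x). Hence Θ([e_m, x]) = [e_m, Θ(x)], and the Lie rule leaves [Θ(e_m), x] = 0.
-/
theorem commute_of_mem_peirce (hK : (2 : K) ≠ 0) (hΘ : IsLieDerivation Θ)
    (he : CompleteOrthogonalIdempotents e)
    (hd : ∀ i k l, k ≠ l → e k * Θ (e i) * e l = 0) {i j : V} (hij : i ≠ j) {x : A}
    (hx : x ∈ peirceSpace K e i j) (m : V) : Θ (e m) * x = x * Θ (e m) := by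
  classical
  have hy := hΘ.map_mem_peirce hK he hd hij hx
  have aux : ∀ y ∈ peirceSpace K e i j, ⁅e m, y⁆ =
      ((if m = i then 1 else 0) - (if j = m then 1 else 0) : K) • y := by
    intro y hy
    rw [Ring.lie_def, sub_smul]
    congr 1
    · rw [← hy.1, ← mul_assoc, he.mul_eq]
      split_ifs with h <;> simp [h]
    · rw [← hy.2, mul_assoc, he.mul_eq]
      split_ifs with h <;> simp
  have h := hΘ (e m) x
  rw [aux x hx, aux _ hy, map_smul, right_eq_add, Ring.lie_def, sub_eq_zero] at h
  exact h

/-- A Lie derivation that maps the idempotents to diagonal elements maps them to central ones. -/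
theorem commute_map_idempotent (hK : (2 : K) ≠ 0) {R : V → V → Prop}
    (hΘ : IsLieDerivation Θ) (he : IsDirectedPeirce K e R)
    (hd : ∀ i k l, k ≠ l → e k * Θ (e i) * e l = 0) (m : V) (x : A) :
    Θ (e m) * x = x * Θ (e m) := by
  classical
  have hidem : ∀ i, Θ (e m) * e i = e i * Θ (e m) := by
    intro i
    refine he.coi.eq_of_peirce fun k l => ?_
    have h1 : e k * (Θ (e m) * e i) * e l = e k * Θ (e m) * (e i * e l) := by noncomm_ring
    have h2 : e k * (e i * Θ (e m)) * e l = (e k * e i) * Θ (e m) * e l := by noncomm_ring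
    rw [h1, h2, he.coi.mul_eq, he.coi.mul_eq]
    by_cases hkl : k = l
    · subst hkl
      by_cases hki : k = i
      · simp [hki]
      · simp [hki, Ne.symm hki]
    · split_ifs with h h'
      · rw [h] at h'; exact absurd h' hkl
      · rw [h, zero_mul, zero_mul, hd m k l hkl]
      · rw [mul_zero, hd m k l hkl]
      · simp
  induction x using he.coi.peirce_induction K with
  | h0 => simp
  | hadd x y hx hy => rw [mul_add, add_mul, hx, hy]
  | h i j x hx =>
    by_cases hij : i = j
    · subst hij
      -- Modulo a multiple of e_i, a diagonal element is a sum of products of off-diagonal elements,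
      -- and these already commute with Θ(e_m).
      obtain ⟨c, hc⟩ := he.diag i x hx
      have h : ∀ z ∈ peirceLoops K e i, Θ (e m) * z = z * Θ (e m) := by
        intro z hz
        induction hz using Submodule.span_induction with
        | mem z hz =>
          obtain ⟨k, hk, q, hq, p, hp, rfl⟩ := hz
          rw [← mul_assoc, hΘ.commute_of_mem_peirce hK he.coi hd hk.symm hq, mul_assoc,
            hΘ.commute_of_mem_peirce hK he.coi hd hk hp, mul_assoc]
        | zero => simp
        | add y z _ _ hy hz => rw [mul_add, add_mul, hy, hz]
        | smul c z _ hz => rw [mul_smul_comm, smul_mul_assoc, hz]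
      have h3 := h _ hc
      rw [mul_sub, sub_mul, mul_smul_comm, smul_mul_assoc, hidem, sub_left_inj] at h3
      exact h3
    · exact hΘ.commute_of_mem_peirce hK he.coi hd hij hx m

end IsLieDerivation

/-! ### From Lie derivations to derivations in the directed case -/

namespace IsDirectedPeirce

variable {R : V → V → Prop}

/-- By antisymmetry `R i k` and `R k i` cannot both hold. The bracket of opposite off-diagonal
components is thus a single product up to sign. -/
theorem mul_eq_zero_or (he : IsDirectedPeirce K e R) {i k : V} (hik : i ≠ k) :
    (∀ q ∈ peirceSpace K e i k, ∀ p ∈ peirceSpace K e k i, q * p = 0) ∨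
      (∀ p ∈ peirceSpace K e k i, ∀ q ∈ peirceSpace K e i k, p * q = 0) := by
  by_cases h : R i k
  · have h' : ¬ R k i := fun h' => hik (he.antisymm _ _ h h')
    exact Or.inr (he.mul_eq_zero k i k h' h')
  · exact Or.inl (he.mul_eq_zero i k i h h)

/-- In (qp)(q'p') through k and m, `R k i` kills qp and `R m i` kills q'p'; if neither holds, the
inner product pq' vanishes. -/
theorem peirceLoops_mul_eq_zero (he : IsDirectedPeirce K e R) {i : V} {x y : A}
    (hx : x ∈ peirceLoops K e i) (hy : y ∈ peirceLoops K e i) : x * y = 0 := by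
  induction hx using Submodule.span_induction with
  | zero => simp
  | add x x' _ _ hx hx' => rw [add_mul, hx, hx', add_zero]
  | smul c x _ hx => rw [smul_mul_assoc, hx, smul_zero]
  | mem x hx =>
    obtain ⟨k, hk, q, hq, p, hp, rfl⟩ := hx
    induction hy using Submodule.span_induction with
    | zero => simp
    | add x x' _ _ hx hx' => rw [mul_add, hx, hx', add_zero]
    | smul c x _ hx => rw [mul_smul_comm, hx, smul_zero]
    | mem y hy =>
      obtain ⟨m, hm, q', hq', p', hp', rfl⟩ := hy
      have key : ∀ k, R k i → k ≠ i → ∀ q ∈ peirceSpace K e i k, ∀ p ∈ peirceSpace K e k i, q * p = 0 := by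
        intro k hk hki
        have h : ¬ R i k := fun h => hki (he.antisymm _ _ hk h)
        exact he.mul_eq_zero i k i h h
      by_cases h : R k i
      · rw [key k h hk q hq p hp, zero_mul]
      by_cases h' : R m i
      · rw [key m h' hm q' hq' p' hp', mul_zero]
      rw [mul_assoc, ← mul_assoc p, he.mul_eq_zero k i m h h' p hp q' hq', zero_mul, mul_zero]

/-- A Lie derivation that kills the idempotents is a derivation. -/
theorem isAssocDerivation (he : IsDirectedPeirce K e R) (hK : (2 : K) ≠ 0) {D : A →ₗ[K] A}
    (hD : IsLieDerivation D) (h0 : ∀ i, D (e i) = 0) : IsAssocDerivation D := by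
  have hoff : ∀ {i j : V}, i ≠ j → ∀ x ∈ peirceSpace K e i j, D x ∈ peirceSpace K e i j := fun hij x hx =>
    hD.map_mem_peirce hK he.coi (fun i k l _ => by rw [h0, mul_zero, zero_mul]) hij hx
  -- When the products in the opposite order vanish, the Lie rule for [x, y] is literally the
  -- Leibniz rule for xy.
  have hmul : ∀ {x y : A}, y * x = 0 → y * D x = 0 → D y * x = 0 →
      D (x * y) = D x * y + x * D y := by
    intro x y h1 h2 h3
    have h := hD x y
    simpa only [Ring.lie_def, h1, h2, h3, sub_zero] using h
  have hprod : ∀ {i k : V}, i ≠ k → ∀ q ∈ peirceSpace K e i k, ∀ p ∈ peirceSpace K e k i,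
      D (q * p) = D q * p + q * D p := by
    intro i k hik q hq p hp
    rcases he.mul_eq_zero_or hik with h | h
    · rw [h q hq p hp, h _ (hoff hik q hq) p hp, h q hq _ (hoff hik.symm p hp), map_zero, add_zero]
    · exact hmul (h p hp q hq) (h p hp _ (hoff hik q hq)) (h _ (hoff hik.symm p hp) q hq)
  have hloops : ∀ {i : V}, ∀ x ∈ peirceLoops K e i, D x ∈ peirceLoops K e i := by
    intro i x hx
    induction hx using Submodule.span_induction with
    | zero => simp
    | add x y _ _ hx hy => rw [map_add]; exact add_mem hx hy
    | smul c x _ hx => rw [map_smul]; exact Submodule.smul_mem _ _ hx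
    | mem x hx =>
      obtain ⟨k, hk, q, hq, p, hp, rfl⟩ := hx
      rw [hprod hk.symm q hq p hp]
      exact add_mem (Submodule.subset_span ⟨k, hk, _, hoff hk.symm q hq, _, hp, rfl⟩)
        (Submodule.subset_span ⟨k, hk, _, hq, _, hoff hk p hp, rfl⟩)
  have hdiag : ∀ {i : V}, ∀ x ∈ peirceSpace K e i i,
      ∃ (c : K) (n : A), n ∈ peirceLoops K e i ∧ x = c • e i + n := by
    intro i x hx
    obtain ⟨c, hc⟩ := he.diag i x hx
    exact ⟨c, _, hc, by abel⟩
  have hall : ∀ {i j : V}, ∀ x ∈ peirceSpace K e i j, D x ∈ peirceSpace K e i j := by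
    intro i j x hx
    by_cases hij : i = j
    · subst hij
      obtain ⟨c, n, hn, rfl⟩ := hdiag x hx
      rw [map_add, map_smul, h0, smul_zero, zero_add]
      exact peirceLoops_le e i (hloops n hn)
    · exact hoff hij x hx
  intro x y
  induction x using he.coi.peirce_induction K with
  | h0 => simp
  | hadd x x' hx hx' => rw [add_mul, map_add, hx, hx', map_add]; noncomm_ring
  | h k j x hx =>
    induction y using he.coi.peirce_induction K with
    | h0 => simp
    | hadd y y' hy hy' => rw [mul_add, map_add, hy, hy', map_add]; noncomm_ring
    | h l i y hy =>
      -- Mismatched inner indices make all terms zero. Distinct outer indices allow `hmul`, and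
      -- opposite off-diagonal components allow `hprod`. Within a single diagonal component, scalars
      -- plus a square-zero part preserved by D give the rule directly.
      by_cases hjl : j = l
      · subst hjl
        by_cases hik : i = k
        · subst hik
          by_cases hij : i = j
          · subst hij
            obtain ⟨c, n, hn, rfl⟩ := hdiag x hx
            obtain ⟨c', n', hn', rfl⟩ := hdiag y hy
            have hn1 := peirceLoops_le e i hn
            have hn1' := peirceLoops_le e i hn'
            have hn2 := peirceLoops_le e i (hloops n hn)
            have hn2' := peirceLoops_le e i (hloops n' hn')
            simp only [add_mul, mul_add, map_add, map_smul, smul_mul_assoc, mul_smul_comm, h0,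
              he.peirceLoops_mul_eq_zero hn hn', he.peirceLoops_mul_eq_zero (hloops n hn) hn',
              he.peirceLoops_mul_eq_zero hn (hloops n' hn'), hn1.2, hn1'.1, hn2.2, hn2'.1,
              (he.coi.idem i).eq, smul_zero, zero_add, add_zero]
          · exact hprod hij x hx y hy
        · exact hmul (he.coi.peirce_mul_eq_zero hik hy hx)
            (he.coi.peirce_mul_eq_zero hik hy (hall x hx))
            (he.coi.peirce_mul_eq_zero hik (hall y hy) hx)
      · rw [he.coi.peirce_mul_eq_zero hjl hx hy, he.coi.peirce_mul_eq_zero hjl (hall x hx) hy,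
          he.coi.peirce_mul_eq_zero hjl hx (hall y hy), map_zero, add_zero]

/-- A Lie derivation agrees with a derivation on the kernel of an augmentation `ε`. -/
theorem exists_isAssocDerivation [DecidableEq V] (he : IsDirectedPeirce K e R) (hK : (2 : K) ≠ 0)
    (ε : A →ₐ[K] (V → K)) (hε : ∀ i, ε (e i) = Pi.single i 1) {Θ : A →ₗ[K] A}
    (hΘ : IsLieDerivation Θ) :
    ∃ D : A →ₗ[K] A, IsAssocDerivation D ∧ ∀ x, ε x = 0 → Θ x = D x := by
  obtain ⟨t, ht⟩ := hΘ.exists_innerLin he.coi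
  have hΘ' := hΘ.sub (isAssocDerivation_innerLin t).isLieDerivation
  set Θ' := Θ - innerLin K t with hΘ't
  -- τ agrees with Θ' on the idempotents and has central values. It vanishes on commutators because
  -- ε has a commutative target, so it is itself a Lie derivation.
  let τ : A →ₗ[K] A := ∑ i, ((LinearMap.proj i).comp ε.toLinearMap).smulRight (Θ' (e i))
  have hτ : ∀ x, τ x = ∑ i, ε x i • Θ' (e i) := by
    intro x
    simp [τ]
  have hcomm : ∀ x y, τ x * y = y * τ x := by
    intro x y
    simp only [hτ, Finset.sum_mul, Finset.mul_sum, smul_mul_assoc, mul_smul_comm,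
      hΘ'.commute_map_idempotent hK he ht _ y]
  have hker : ∀ x, ε x = 0 → τ x = 0 := fun x hx => by simp [hτ, hx]
  have hD : IsLieDerivation (Θ' - τ) := by
    refine hΘ'.sub fun a b => ?_
    rw [hker _ (by rw [Ring.lie_def, map_sub, map_mul, map_mul, mul_comm, sub_self]),
      Ring.lie_def, Ring.lie_def, hcomm a b, hcomm b a]
    simp
  -- This sum is Θ - τ, and τ vanishes on the kernel of ε.
  refine ⟨(Θ' - τ) + innerLin K t, (he.isAssocDerivation hK hD fun i => ?_).add
    (isAssocDerivation_innerLin t), fun x hx => ?_⟩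
  · rw [LinearMap.sub_apply, hτ, hε, Finset.sum_eq_single i]
    · simp
    · intro j _ hj
      simp [hj]
    · exact fun hh => absurd (Finset.mem_univ _) hh
  · simp [hΘ't, hker x hx]

end IsDirectedPeirce

end Peirce
-- Paths and the augmentation of a path algebra
-- Paths grow at their end, but in a product pq* the first arrows of p and q meet, so the first
-- arrow has to be split off.
theorem Quiver.Path.exists_eq_toPath_comp {V : Type v} [Quiver.{w} V] {a b : V} (p : Path a b)
    (hp : p.length ≠ 0) : ∃ (c : V) (α : a ⟶ c) (q : Path c b), p = α.toPath.comp q := by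
  induction p with
  | nil => exact absurd rfl hp
  | @cons b c p β ih =>
    cases p with
    | nil => exact ⟨_, β, Path.nil, rfl⟩
    | cons p γ =>
      obtain ⟨d, α, q, h⟩ := ih (Nat.succ_ne_zero _)
      exact ⟨d, α, q.cons β, by rw [h, Path.comp_cons]⟩

namespace PathAlgebra

variable {K : Type u} [Field K] {V : Type v} [Quiver.{w + 1} V]

theorem completeOrthogonalIdempotents_idem [Fintype V] :
    CompleteOrthogonalIdempotents (fun i : V => idem K i) where
  idem i := by
    change idem K i * idem K i = idem K i
    rw [idem, ofPath_mul_ofPath, pathMul_comp, Path.comp_nil]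
  ortho i j hij := by
    change idem K i * idem K j = 0
    rw [idem, idem, ofPath_mul_ofPath, pathMul_of_ne (by exact hij.symm)]
  complete := rfl

open Classical in
variable (K V) in
/-- The linear map that sends `e i` to the `i`-th unit vector and nontrivial paths to zero. -/
def augmentationLin : PathAlgebra K V →ₗ[K] (V → K) :=
  (basis K V).constr K fun p => if p.length = 0 then Pi.single p.1 1 else 0

open Classical in
theorem augmentationLin_ofPath (p : QuiverPath V) :
    augmentationLin K V (ofPath K p) = if p.length = 0 then Pi.single p.1 1 else 0 := by
  rw [augmentationLin, ← basis_apply, Module.Basis.constr_basis]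

open Classical in
theorem augmentationLin_idem (i : V) : augmentationLin K V (idem K i) = Pi.single i 1 := by
  rw [idem, augmentationLin_ofPath]
  exact if_pos rfl

theorem augmentationLin_of_isNontrivial {p : QuiverPath V} (hp : p.IsNontrivial) :
    augmentationLin K V (ofPath K p) = 0 := by
  rw [augmentationLin_ofPath, if_neg (Nat.one_le_iff_ne_zero.1 hp)]

/-- Lengths add, so a composite is trivial only if both factors are. Trivial paths at distinct
vertices go to orthogonal unit vectors, matching their zero product. -/
theorem augmentationLin_ofPath_mul (x y : QuiverPath V) :
    augmentationLin K V (ofPath K x * ofPath K y) =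
      augmentationLin K V (ofPath K x) * augmentationLin K V (ofPath K y) := by
  classical
  obtain ⟨b, c, p⟩ := x
  obtain ⟨a, b', q⟩ := y
  rw [ofPath_mul_ofPath]
  simp only [augmentationLin_ofPath]
  by_cases h : b' = b
  · subst h
    rw [pathMul_comp, augmentationLin_ofPath]
    simp only [QuiverPath.length, Path.length_comp]
    cases q with
    | nil =>
      by_cases hp : p.length = 0
      · simp [hp, ← Pi.single_mul]
      · simp [hp]
    | cons q β => simp
  · rw [pathMul_of_ne (by exact h), map_zero]
    by_cases hq : q.length = 0
    · have hab := q.eq_of_length_zero hq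
      subst hab
      by_cases hp : p.length = 0
      · rw [if_pos (by exact hp), if_pos (by exact hq)]
        ext i
        by_cases hi : i = b
        · subst hi; simp [Ne.symm h]
        · simp [hi]
      · simp [QuiverPath.length, hp]
    · simp [QuiverPath.length, hq]

variable (K V) in
/-- The augmentation `KΓ → K ^ Γ₀`. -/
def augmentation [Fintype V] : PathAlgebra K V →ₐ[K] (V → K) :=
  AlgHom.ofLinearMap (augmentationLin K V)
    (by
      classical
      rw [one_def, map_sum]
      simp only [augmentationLin_idem]
      exact Finset.univ_sum_single 1)
    (by
      intro x y
      induction x using induction_on with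
      | h0 => simp
      | hadd x x' hx hx' => rw [add_mul, map_add, hx, hx', map_add, add_mul]
      | hsmul k p =>
        induction y using induction_on with
        | h0 => simp
        | hadd y y' hy hy' => rw [mul_add, map_add, hy, hy', map_add, mul_add]
        | hsmul l q =>
          simp only [smul_mul_assoc, mul_smul_comm, map_smul, augmentationLin_ofPath_mul])

theorem IsRelation.map_eq_zero {M : Type*} [AddCommGroup M] [Module K M] {σ : PathAlgebra K V}
    (hσ : σ.IsRelation) (f : PathAlgebra K V →ₗ[K] M)
    (hf : ∀ p : QuiverPath V, p.IsNontrivial → f (ofPath K p) = 0) : f σ = 0 := by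
  obtain ⟨a, b, h⟩ := hσ
  induction h using Submodule.span_induction with
  | mem x hx => obtain ⟨p, hp, rfl⟩ := hx; exact hf _ (one_le_two.trans hp)
  | zero => exact map_zero f
  | add x y _ _ hx hy => rw [map_add, hx, hy, add_zero]
  | smul c x _ hx => rw [map_smul, hx, smul_zero]

end PathAlgebra

theorem Quiver.Path.length_reverse {V : Type v} [Quiver.{w} V] [HasReverse V] {a b : V}
    (p : Path a b) : p.reverse.length = p.length := by
  induction p with
  | nil => rfl
  | cons p β ih => rw [Path.reverse, Path.length_comp, ih, Path.length_cons, add_comm]; rfl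

theorem Prefunctor.length_mapPath {V : Type*} [Quiver V] {W : Type*} [Quiver W]
    (F : V ⥤q W) {a b : V} (p : Path a b) : (F.mapPath p).length = p.length := by
  induction p with
  | nil => rfl
  | cons p β ih => rw [Prefunctor.mapPath_cons, Path.length_cons, ih, Path.length_cons]

section

variable {V : Type v} [Quiver.{w + 1} V]

theorem QuiverPath.IsNontrivial.pathIncl {p : QuiverPath V} (hp : p.IsNontrivial) :
    (pathIncl p).IsNontrivial := by
  unfold QuiverPath.IsNontrivial QuiverPath.length _root_.pathIncl at *
  rwa [Prefunctor.length_mapPath]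

theorem QuiverPath.IsNontrivial.pathStar {p : QuiverPath V} (hp : p.IsNontrivial) :
    (pathStar p).IsNontrivial := by
  unfold QuiverPath.IsNontrivial QuiverPath.length _root_.pathStar at *
  rwa [Path.length_reverse, Prefunctor.length_mapPath]

end

/-! ### The Peirce structure and augmentation of the dual extension -/

namespace DualExtension

open PathAlgebra

variable {K : Type u} [Field K] {V : Type v} [Quiver.{w + 1} V] [Fintype V]
  (ρ : Set (PathAlgebra K V))

/-- The class of the trivial path at a vertex. -/
def vertex (i : V) : DualExtension ρ :=
  BoundPathAlgebra.mk (dualRelations ρ) (idem K (V := Symmetrify V) i)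

/-- The class of a path of `Γ`. -/
def forward {a b : V} (p : Path a b) : DualExtension ρ :=
  BoundPathAlgebra.mk _ (ofPath K (pathIncl ⟨a, b, p⟩))

/-- The class of the reverse of a path of `Γ`. -/
def backward {a b : V} (p : Path a b) : DualExtension ρ :=
  BoundPathAlgebra.mk _ (ofPath K (pathStar ⟨a, b, p⟩))

theorem completeOrthogonalIdempotents_vertex : CompleteOrthogonalIdempotents (vertex ρ) :=
  (completeOrthogonalIdempotents_idem (V := Symmetrify V)).map
    (BoundPathAlgebra.mk (dualRelations ρ)).toRingHom

theorem forward_nil (a : V) : forward ρ (Path.nil : Path a a) = vertex ρ a := rfl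

theorem backward_nil (a : V) : backward ρ (Path.nil : Path a a) = vertex ρ a := rfl

theorem mk_mul_mk {a b c : Symmetrify V} (p : Path b c) (q : Path a b) :
    BoundPathAlgebra.mk (dualRelations ρ) (ofPath K ⟨b, c, p⟩) *
      BoundPathAlgebra.mk (dualRelations ρ) (ofPath K ⟨a, b, q⟩) =
      BoundPathAlgebra.mk (dualRelations ρ) (ofPath K ⟨a, c, q.comp p⟩) := by
  rw [← map_mul, ofPath_mul_ofPath, pathMul_comp]

theorem forward_mul_forward {a b c : V} (p : Path b c) (q : Path a b) :
    forward ρ p * forward ρ q = forward ρ (q.comp p) := by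
  refine (mk_mul_mk ρ _ _).trans ?_
  rw [forward, pathIncl, Prefunctor.mapPath_comp]

theorem backward_mul_backward {a b c : V} (p : Path a b) (q : Path b c) :
    backward ρ p * backward ρ q = backward ρ (p.comp q) := by
  refine (mk_mul_mk ρ _ _).trans ?_
  rw [backward, pathStar, Prefunctor.mapPath_comp, Path.reverse_comp]

theorem forward_mem {a b : V} (p : Path a b) :
    forward ρ p ∈ peirceSpace K (vertex ρ) b a :=
  ⟨by rw [← forward_nil, forward_mul_forward, Path.comp_nil],
    by rw [← forward_nil, forward_mul_forward, Path.nil_comp]⟩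

theorem backward_mem {a b : V} (p : Path a b) :
    backward ρ p ∈ peirceSpace K (vertex ρ) a b :=
  ⟨by rw [← backward_nil, backward_mul_backward, Path.nil_comp],
    by rw [← backward_nil, backward_mul_backward, Path.comp_nil]⟩

theorem arrow_mul_arrow {a b c d : V} (α : a ⟶ b) (β : c ⟶ d) :
    forward ρ α.toPath * backward ρ β.toPath = 0 := by
  rw [forward, backward, ← map_mul, BoundPathAlgebra.mk_eq_zero_iff]
  exact TwoSidedIdeal.subset_span (Or.inr ⟨a, b, c, d, α, β, rfl⟩)

theorem forward_mul_backward {a b c d : V} (p : Path a b) (q : Path c d) (hp : p.length ≠ 0)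
    (hq : q.length ≠ 0) : forward ρ p * backward ρ q = 0 := by
  obtain ⟨_, α, p, rfl⟩ := p.exists_eq_toPath_comp hp
  obtain ⟨_, β, q, rfl⟩ := q.exists_eq_toPath_comp hq
  rw [← forward_mul_forward, ← backward_mul_backward, mul_assoc, ← mul_assoc (forward ρ α.toPath),
    arrow_mul_arrow, zero_mul, mul_zero]

theorem forward_toPath_mul {a b c m : V} (α : b ⟶ c) (q : Path b m) (p : Path a m) :
    forward ρ α.toPath * (backward ρ q * forward ρ p) = 0 ∨
      ∃ (n : V) (q' : Path c n) (p' : Path a n),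
        forward ρ α.toPath * (backward ρ q * forward ρ p) = backward ρ q' * forward ρ p' := by
  by_cases hq : q.length = 0
  · have hb := q.eq_of_length_zero hq
    subst hb
    rw [q.eq_nil_of_length_zero hq, backward_nil, (forward_mem ρ p).1]
    exact Or.inr ⟨c, Path.nil, p.comp α.toPath, by
      rw [forward_mul_forward, backward_nil, (forward_mem ρ _).1]⟩
  · rw [← mul_assoc, forward_mul_backward ρ α.toPath q one_ne_zero hq, zero_mul]
    exact Or.inl rfl

theorem backward_toPath_mul {a b c m : V} (β : c ⟶ b) (q : Path b m) (p : Path a m) :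
    backward ρ β.toPath * (backward ρ q * forward ρ p) =
      backward ρ (β.toPath.comp q) * forward ρ p := by
  rw [← backward_mul_backward, mul_assoc]

/-- Normal form q*p, by induction on the last arrow. A reversed arrow lengthens q; an arrow of Γ
lengthens p if q is trivial, and otherwise meets a reversed arrow and gives zero. -/
theorem mk_eq_zero_or {a b : Symmetrify V} (P : Path a b) :
    BoundPathAlgebra.mk (dualRelations ρ) (ofPath K ⟨a, b, P⟩) = 0 ∨
      ∃ (m : V) (q : Path (V := V) b m) (p : Path (V := V) a m),
        BoundPathAlgebra.mk (dualRelations ρ) (ofPath K ⟨a, b, P⟩) =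
          backward ρ q * forward ρ p := by
  induction P with
  | nil =>
    exact Or.inr ⟨a, Path.nil, Path.nil, ((completeOrthogonalIdempotents_vertex ρ).idem a).eq.symm⟩
  | @cons b c P γ ih =>
    have h : BoundPathAlgebra.mk (dualRelations ρ) (ofPath K ⟨a, c, P.cons γ⟩) =
        BoundPathAlgebra.mk (dualRelations ρ) (ofPath K ⟨b, c, γ.toPath⟩) *
        BoundPathAlgebra.mk (dualRelations ρ) (ofPath K ⟨a, b, P⟩) :=
      (mk_mul_mk ρ γ.toPath P).symm
    rw [h]
    rcases ih with h0 | ⟨m, q, p, hP⟩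
    · exact Or.inl (by rw [h0, mul_zero])
    rw [hP]
    rcases γ with α | β
    · exact forward_toPath_mul ρ α q p
    · exact Or.inr ⟨m, (Hom.toPath (V := V) β).comp q, p, backward_toPath_mul ρ β q p⟩

theorem peirceSpace_le_span (i j : V) : peirceSpace K (vertex ρ) i j ≤
    Submodule.span K {z | ∃ (m : V) (q : Path i m) (p : Path j m),
      z = backward ρ q * forward ρ p} := by
  intro x hx
  have hv := completeOrthogonalIdempotents_vertex ρ
  -- Writing x as e_i x e_j makes membership in the component automatic, so x can be replaced by a
  -- single path in what follows.
  rw [← hx.2, ← hx.1]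
  clear hx
  obtain ⟨x, rfl⟩ := BoundPathAlgebra.mk_surjective _ x
  induction x using PathAlgebra.induction_on with
  | h0 => simp
  | hadd x y hx hy => rw [map_add, mul_add, add_mul]; exact add_mem hx hy
  | hsmul k P =>
    obtain ⟨a, b, P⟩ := P
    rw [map_smul, mul_smul_comm, smul_mul_assoc]
    refine Submodule.smul_mem _ _ ?_
    rcases mk_eq_zero_or ρ P with h | ⟨m, q, p, h⟩
    · simp [h]
    rw [h]
    have hqp := mul_mem_peirceSpace (backward_mem ρ q) (forward_mem ρ p)
    by_cases hb : i = b
    · subst hb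
      by_cases ha : a = j
      · subst ha
        refine Submodule.subset_span ⟨m, q, p, ?_⟩
        rw [hqp.1, hqp.2]
      · rw [hqp.1, ← hqp.2, mul_assoc, hv.ortho ha, mul_zero]
        exact zero_mem _
    · rw [← hqp.1, ← mul_assoc, hv.ortho hb, zero_mul, zero_mul]
      exact zero_mem _

/-- The dual extension of an algebra of an acyclic quiver is directed by reachability. -/
theorem isDirectedPeirce (hΓ : HasNoOrientedCycles V) :
    IsDirectedPeirce K (vertex ρ) fun i j : V => Nonempty (Path i j) where
  coi := completeOrthogonalIdempotents_vertex ρ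
  antisymm := by
    rintro i j ⟨p⟩ ⟨q⟩
    have h := (p.length_comp q).symm.trans (hΓ i (p.comp q))
    exact p.eq_of_length_zero (by omega)
  mul_eq_zero := by
    intro k i m hki hmi x hx y hy
    replace hx := peirceSpace_le_span ρ k i hx
    replace hy := peirceSpace_le_span ρ i m hy
    induction hx using Submodule.span_induction with
    | zero => simp
    | add x x' _ _ hx hx' => rw [add_mul, hx, hx', add_zero]
    | smul c x _ hx => rw [smul_mul_assoc, hx, smul_zero]
    | mem x hx =>
      obtain ⟨s, q, p, rfl⟩ := hx
      induction hy using Submodule.span_induction with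
      | zero => simp
      | add x x' _ _ hx hx' => rw [mul_add, hx, hx', add_zero]
      | smul c x _ hx => rw [mul_smul_comm, hx, smul_zero]
      | mem y hy =>
        obtain ⟨t, q', p', rfl⟩ := hy
        -- In (q*p)(q'*p'), a trivial p would make q a path from k to i, and a trivial q' would make
        -- p' a path from m to i. Both being nontrivial, the middle factor pq'* vanishes.
        have hp : p.length ≠ 0 := fun h => hki (by rw [p.eq_of_length_zero h]; exact ⟨q⟩)
        have hq : q'.length ≠ 0 := fun h => hmi (by rw [q'.eq_of_length_zero h]; exact ⟨p'⟩)
        rw [mul_assoc, ← mul_assoc (forward ρ p), forward_mul_backward ρ p q' hp hq, zero_mul,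
          mul_zero]
  diag := by
    intro i x hx
    replace hx := peirceSpace_le_span ρ i i hx
    induction hx using Submodule.span_induction with
    | zero => exact ⟨0, by simp⟩
    | add x y _ _ hx hy =>
      obtain ⟨c, hc⟩ := hx
      obtain ⟨d, hd⟩ := hy
      refine ⟨c + d, ?_⟩
      rw [add_smul, add_sub_add_comm]
      exact add_mem hc hd
    | smul k x _ hx =>
      obtain ⟨c, hc⟩ := hx
      refine ⟨k * c, ?_⟩
      rw [mul_smul, ← smul_sub]
      exact Submodule.smul_mem _ _ hc
    | mem x hx =>
      obtain ⟨m, q, p, rfl⟩ := hx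
      -- If the turning vertex m is i, acyclicity makes p and q trivial and q*p = e_i. Otherwise q*
      -- and p are themselves off-diagonal.
      by_cases hm : m = i
      · subst hm
        refine ⟨1, ?_⟩
        rw [q.eq_nil_of_length_zero (hΓ _ q), p.eq_nil_of_length_zero (hΓ _ p), backward_nil,
          forward_nil, ((completeOrthogonalIdempotents_vertex ρ).idem _).eq, one_smul, sub_self]
        exact zero_mem _
      · refine ⟨0, ?_⟩
        rw [zero_smul, sub_zero]
        exact Submodule.subset_span
          ⟨m, hm, _, backward_mem ρ q, _, forward_mem ρ p, rfl⟩

/-- The augmentation of the dual extension. -/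
def augmentation (hρ : ∀ σ ∈ ρ, σ.IsRelation) : DualExtension ρ →ₐ[K] (V → K) :=
  BoundPathAlgebra.lift _ (PathAlgebra.augmentation K (Symmetrify V)) (by
    rintro _ ((⟨σ, hσ, rfl⟩ | ⟨σ, hσ, rfl⟩) | ⟨a, b, c, d, α, β, rfl⟩)
    · refine (hρ σ hσ).map_eq_zero
        ((PathAlgebra.augmentationLin K (Symmetrify V)).comp (inclLin K V)) fun p hp => ?_
      rw [LinearMap.comp_apply, inclLin_ofPath]
      exact augmentationLin_of_isNontrivial hp.pathIncl
    · refine (hρ σ hσ).map_eq_zero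
        ((PathAlgebra.augmentationLin K (Symmetrify V)).comp (starLin K V)) fun p hp => ?_
      rw [LinearMap.comp_apply, starLin_ofPath]
      exact augmentationLin_of_isNontrivial hp.pathStar
    · refine (map_mul (PathAlgebra.augmentation K (Symmetrify V)) _ _).trans ?_
      exact mul_eq_zero_of_left (augmentationLin_of_isNontrivial
        (QuiverPath.IsNontrivial.pathIncl (p := arrowPath α) le_rfl)) _)

open Classical in
theorem augmentation_vertex (hρ : ∀ σ ∈ ρ, σ.IsRelation) (i : V) :
    augmentation ρ hρ (vertex ρ i) = Pi.single i 1 :=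
  augmentationLin_idem (V := Symmetrify V) i

theorem augmentation_eq_zero (hρ : ∀ σ ∈ ρ, σ.IsRelation) {y : DualExtension ρ}
    (hy : y ∈ BoundPathAlgebra.nontrivialSpan (dualRelations ρ)) : augmentation ρ hρ y = 0 := by
  induction hy using Submodule.span_induction with
  | mem y hy => obtain ⟨p, hp, rfl⟩ := hy; exact augmentationLin_of_isNontrivial hp
  | zero => exact map_zero _
  | add x y _ _ hx hy => rw [map_add, hx, hy, add_zero]
  | smul c x _ hx => rw [map_smul, hx, smul_zero]

theorem toDualExtension_mem_nontrivialSpan {x : BoundPathAlgebra ρ}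
    (hx : x ∈ BoundPathAlgebra.nontrivialSpan ρ) :
    toDualExtension ρ x ∈ BoundPathAlgebra.nontrivialSpan (dualRelations ρ) := by
  induction hx using Submodule.span_induction with
  | mem x hx =>
    obtain ⟨p, hp, rfl⟩ := hx
    exact Submodule.subset_span ⟨pathIncl p, hp.pathIncl,
      congrArg (BoundPathAlgebra.mk (dualRelations ρ)) (inclLin_ofPath p)⟩
  | zero => rw [map_zero]; exact zero_mem _
  | add x y _ _ hx hy => rw [map_add]; exact add_mem hx hy
  | smul c x _ hx => rw [map_smul]; exact Submodule.smul_mem _ _ hx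

end DualExtension
end

theorem corollary4p4 {K : Type u} [Field K] (hK : ringChar K ≠ 2)
    {V : Type v} [Fintype V] [Quiver.{w + 1} V] [∀ a b : V, Finite (a ⟶ b)]
    (hΓ : HasNoOrientedCycles V)
    (ρ : Set (PathAlgebra K V)) (hρ : ∀ σ ∈ ρ, σ.IsRelation)
    (Θ : DualExtension ρ →ₗ[K] DualExtension ρ) (hΘ : IsLieDerivation Θ) :
    ∃ D : DualExtension ρ →ₗ[K] DualExtension ρ, IsAssocDerivation D ∧
      (∀ x ∈ BoundPathAlgebra.nontrivialSpan ρ,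
        Θ (toDualExtension ρ x) = D (toDualExtension ρ x)) ∧
      (∀ y ∈ BoundPathAlgebra.nontrivialSpan (dualRelations ρ), Θ y = D y) := by
  classical
  obtain ⟨D, hD, h⟩ := (DualExtension.isDirectedPeirce ρ hΓ).exists_isAssocDerivation
    (Ring.two_ne_zero hK) (DualExtension.augmentation ρ hρ)
    (DualExtension.augmentation_vertex ρ hρ) hΘ
  have hy : ∀ y ∈ BoundPathAlgebra.nontrivialSpan (dualRelations ρ), Θ y = D y := fun y hy =>
    h y (DualExtension.augmentation_eq_zero ρ hρ hy)
  exact ⟨D, hD, fun x hx => hy _ (DualExtension.toDualExtension_mem_nontrivialSpan ρ hx), hy⟩
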